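/- **Proposition (causal character of the mean curvature).** Let $I\subset\mathbb R$ be an open interval and $f:I\to(0,\infty)$ smooth. Let $\mathbb S^3=\{(z,w)\in\mathbb C^2:|z|^2+|w|^2=1\}$ and $\mathbb S^2(1/2)=\{(z,x)\in\mathbb C\times\mathbb R:|z|^2+x^2=1/4\}$ carry their standard metrics $g_{\mathbb S^3}$, $g_{\mathbb S^2(1/2)}$, let $\pi:\mathbb S^3\to\mathbb S^2(1/2)$, $\pi(z,w)=(z\overline w,\tfrac12|z|^2-\tfrac12|w|^2)$, be the Hopf map, and consider the Lorentzian warped products $\overline M^4_1=I\times_f\mathbb S^3$ with metric $\overline g_4=-dt^2+f^2g_{\mathbb S^3}$ and $\overline M^3_1=I\times_f\mathbb S^2(1/2)$ (the toy model) with metric $\overline g_3=-dt^2+f^2g_{\mathbb S^2(1/2)}$, and the projection $\overline\pi:\overline M^4_1\to\overline M^3_1$, $\overline\pi(t,p)=(t,\pi(p))$. Fix an orientation of $\mathbb S^2(1/2)$ and orient $\overline M^3_1$ so that $\{\partial_t,X,Y\}$ is positive for every positive tangent frame $\{X,Y\}$ of $\mathbb S^2(1/2)$. Let $J\subset\mathbb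 R$ be an open interval and let $\alpha=(t,\alpha_2):J\to\overline M^3_1$ be a unit spacelike Frenet curve: $\alpha$ is smooth and there are smooth vector fields $N,B$ along $\alpha$, smooth functions $\kappa>0$ and $\tau$ on $J$, and signs $\epsilon_2=-\epsilon_3=\pm1$ such that, with $T=\dot\alpha$, the frame $\{T,N,B\}$ is positive and $\overline g_3$-orthogonal, $\overline g_3(T,T)=1$, $\overline g_3(N,N)=\epsilon_2$, $\overline g_3(B,B)=\epsilon_3$, and, for the Levi-Civita connection $\nabla$ of $\overline M^3_1$, $$\nabla_TT=\epsilon_2\kappa N,\qquad \nabla_TN=-\kappa T+\epsilon_3\tau B,\qquad \nabla_TB=-\epsilon_2\tau N .$$ Let $\beta=(t,\beta_2):J\to\overline M^4_1$ be a horizontal lift of $\alpha$, i.e. a smooth curve with $\overline\pi\circ\beta=\alpha$ and $\dot\beta$ orthogonal to the kernel of $d\overline\pi$, and put $$\phi:S=J\times\mathbb S^1\to\overline M^4_1,\qquad \phi(s,e^{i\theta})=(t(s),e^{i\theta}\beta_2(s)).$$ Then $\phi$ is a spacelike immersion, and for every $(s,e^{i\theta})\in S$ its mean curvature vector $\vec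 H_\phi=\tfrac12\,\mathrm{trace}\,h_\phi$ at $(s,e^{i\theta})$ is spacelike ($\overline g_4(\vec H_\phi,\vec H_\phi)>0$), respectively lightlike or zero, respectively timelike ($\overline g_4(\vec H_\phi,\vec H_\phi)<0$), if and only if $$\epsilon_2\Big(\kappa+\frac{f'}{f}\,\overline g_3(\partial_t,N)\Big)^2+\epsilon_3\Big(\frac{f'}{f}\,\overline g_3(\partial_t,B)\Big)^2$$ is $>0$, respectively $=0$, respectively $<0$, where $\kappa,N,B$ are evaluated at $s$, $\partial_t$ at $\alpha(s)$, and $f,f'$ at $t(s)$. -/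

import Mathlib

open scoped ContDiff

namespace WarpedHopf

noncomputable section

/-! ## Semi-Riemannian submanifolds of a vector space

A semi-Riemannian submanifold `M` of a normed space `E` is handled through a metric tensor `g`
defined at the points of (an open subset of) `E` and through its tangent spaces `T p ⊆ E`.
The metric of `M` is the restriction of `g p` to `T p`. -/

section Submanifold

variable {E : Type*} [NormedAddCommGroup E] [NormedSpace ℝ E]

/-- The derivative at `p`, in the direction `v`, of the component `g (X, Y)` of the metric tensor
on constant vector fields `X`, `Y` of the ambient vector space. -/
def metricDeriv (g : E → E → E → ℝ) (p v X Y : E) : ℝ :=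
  deriv (fun u : ℝ => g (p + u • v) X Y) 0

/-- `D` is the Levi-Civita covariant derivative at `s` of the field `W` (tangent to `M`) along the
curve `c` in `M`. This is the Koszul formula: the three derivatives of the metric are the
Christoffel symbols (of the first kind) of `g` in the affine coordinates of `E`, and restricting to
test vectors `Z` tangent to `M` is the projection onto `M` (Gauss formula). -/
def IsCovDeriv (g : E → E → E → ℝ) (T : E → Submodule ℝ E) (c W : ℝ → E) (s : ℝ) (D : E) : Prop :=
  D ∈ T (c s) ∧ ∀ Z ∈ T (c s),
    g (c s) D Z = g (c s) (deriv W s) Z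
      + (1 / 2) * (metricDeriv g (c s) (deriv c s) (W s) Z
        + metricDeriv g (c s) (W s) (deriv c s) Z
        - metricDeriv g (c s) Z (deriv c s) (W s))

open Classical in
/-- The Levi-Civita covariant derivative of the field `W` along the curve `c`. -/
def covDeriv (g : E → E → E → ℝ) (T : E → Submodule ℝ E) (c W : ℝ → E) (s : ℝ) : E :=
  if h : ∃ D, IsCovDeriv g T c W s D then h.choose else 0

/-! ### Surfaces

`x : ℝ × ℝ → E` is a (local) parametrization of a surface immersed in `M`. -/

/-- The coordinate vectors of the parameter plane. -/
def coordVec : Fin 2 → ℝ × ℝ := ![(1, 0), (0, 1)]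

/-- The matrix of the first fundamental form in the coordinates of the parametrization. -/
def firstForm (g : E → E → E → ℝ) (x : ℝ × ℝ → E) (q : ℝ × ℝ) : Matrix (Fin 2) (Fin 2) ℝ :=
  Matrix.of fun i j => g (x q) (fderiv ℝ x q (coordVec i)) (fderiv ℝ x q (coordVec j))

/-- The component of `X` normal to the surface, with respect to the metric `g`. -/
def normalPart (g : E → E → E → ℝ) (x : ℝ × ℝ → E) (q : ℝ × ℝ) (X : E) : E :=
  X - ∑ i, ∑ j, ((firstForm g x q)⁻¹ i j * g (x q) X (fderiv ℝ x q (coordVec i))) •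
    fderiv ℝ x q (coordVec j)

/-- The second fundamental form `h(v, w)`: the normal component of the covariant derivative, in
the direction `v`, of the field `dx(w)` along the surface. -/
def secondForm (g : E → E → E → ℝ) (T : E → Submodule ℝ E) (x : ℝ × ℝ → E) (q v w : ℝ × ℝ) : E :=
  normalPart g x q
    (covDeriv g T (fun u : ℝ => x (q + u • v)) (fun u : ℝ => fderiv ℝ x (q + u • v) w) 0)

/-- The mean curvature vector: half the trace of the second fundamental form with respect to the
first one. -/
def meanCurvature (g : E → E → E → ℝ) (T : E → Submodule ℝ E) (x : ℝ × ℝ → E) (q : ℝ × ℝ) : E :=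
  (1 / 2 : ℝ) • ∑ i, ∑ j, (firstForm g x q)⁻¹ i j • secondForm g T x q (coordVec i) (coordVec j)

/-- `x` restricts to a smooth immersion of `U` in `M`, with positive definite induced metric. -/
structure IsSpacelikeImmersion (g : E → E → E → ℝ) (M : Set E) (x : ℝ × ℝ → E)
    (U : Set (ℝ × ℝ)) : Prop where
  smooth : ContDiffOn ℝ ∞ x U
  mapsTo : ∀ q ∈ U, x q ∈ M
  posDef : ∀ q ∈ U, ∀ v : ℝ × ℝ, v ≠ 0 → 0 < g (x q) (fderiv ℝ x q v) (fderiv ℝ x q v)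

/-- Spacelike nonzero vectors. -/
def IsSpacelike (g : E → E → E → ℝ) (p X : E) : Prop := 0 < g p X X

/-- Timelike vectors. -/
def IsTimelike (g : E → E → E → ℝ) (p X : E) : Prop := g p X X < 0

/-- Lightlike (null) vectors. -/
def IsLightlike (g : E → E → E → ℝ) (p X : E) : Prop := X ≠ 0 ∧ g p X X = 0

end Submanifold

/-! ## The warped product `I ×_f S`, where `S` is a round sphere centred at the origin of `V` -/

section Warped

variable {V : Type*} [NormedAddCommGroup V] [InnerProductSpace ℝ V]

/-- The points of `I × S`, where `S` is the sphere of radius `r` in `V`. -/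
def warpedProduct (V : Type*) [NormedAddCommGroup V] (I : Set ℝ) (r : ℝ) : Set (ℝ × V) :=
  I ×ˢ Metric.sphere (0 : V) r

/-- The tangent space of `I × S` at `p`: the second component is tangent to the sphere. -/
def warpedTangent (p : ℝ × V) : Submodule ℝ (ℝ × V) where
  carrier := {X | inner ℝ p.2 X.2 = 0}
  add_mem' := by
    intro X Y hX hY
    simp only [Set.mem_ofPred_eq, Prod.snd_add, inner_add_right] at *
    rw [hX, hY, add_zero]
  zero_mem' := by simp
  smul_mem' := by
    intro a X hX
    simp only [Set.mem_ofPred_eq, Prod.smul_snd, inner_smul_right] at *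
    rw [hX, mul_zero]

/-- The warped metric `-dt² + f(t)² ⟨·,·⟩`. -/
def warpedMetric (f : ℝ → ℝ) (p X Y : ℝ × V) : ℝ :=
  -(X.1 * Y.1) + f p.1 ^ 2 * inner ℝ X.2 Y.2

/-- The coordinate vector field `∂_t`. -/
def dt : ℝ × V := (1, 0)

theorem metricDeriv_warped (f : ℝ → ℝ) (p v X Y : ℝ × V) (hf : DifferentiableAt ℝ f p.1) :
    metricDeriv (warpedMetric f) p v X Y
      = 2 * f p.1 * deriv f p.1 * v.1 * inner ℝ X.2 Y.2 := by
  have h0 : HasDerivAt (fun u : ℝ => p.1 + u * v.1) v.1 0 := by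
    simpa using ((hasDerivAt_id (0 : ℝ)).mul_const v.1).const_add p.1
  have hf' : HasDerivAt f (deriv f p.1) ((fun u : ℝ => p.1 + u * v.1) 0) := by
    simpa using hf.hasDerivAt
  have h1 := ((hf'.comp (0 : ℝ) h0).pow 2).mul_const (inner ℝ X.2 Y.2)
  have h2 := h1.const_add (-(X.1 * Y.1))
  unfold metricDeriv
  have h3 := h2.deriv
  simp only [Function.comp_def, Pi.pow_apply] at h3
  simp only [warpedMetric, Prod.fst_add, Prod.smul_fst, smul_eq_mul]
  rw [h3]
  simp only [zero_mul, add_zero, Nat.cast_ofNat, Nat.add_one_sub_one, pow_one]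
  ring

/-- The value of the covariant derivative along a curve in a warped product. -/
theorem isCovDeriv_warped (f : ℝ → ℝ) (c W : ℝ → ℝ × V) (s : ℝ)
    (hf : DifferentiableAt ℝ f (c s).1) (hf0 : f (c s).1 ≠ 0) (hc : (c s).2 ≠ 0) (Y : V)
    (hY : Y = (deriv W s).2 + (deriv f (c s).1 / f (c s).1) •
      ((deriv c s).1 • (W s).2 + (W s).1 • (deriv c s).2)) :
    IsCovDeriv (warpedMetric f) warpedTangent c W s
      ((deriv W s).1 + f (c s).1 * deriv f (c s).1 * inner ℝ (deriv c s).2 (W s).2,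
        Y - (inner ℝ (c s).2 Y / inner ℝ (c s).2 (c s).2 : ℝ) • (c s).2) := by
  subst hY
  have hpp : (inner ℝ (c s).2 (c s).2 : ℝ) ≠ 0 := inner_self_ne_zero.mpr hc
  refine ⟨?_, ?_⟩
  · change inner ℝ (c s).2 (_ - (_ : ℝ) • (c s).2) = 0
    rw [inner_sub_right, inner_smul_right, div_mul_cancel₀ _ hpp, sub_self]
  · intro Z hZ
    have hZ' : (inner ℝ (c s).2 Z.2 : ℝ) = 0 := hZ
    simp only [metricDeriv_warped _ _ _ _ _ hf]
    simp only [warpedMetric, inner_sub_left, real_inner_smul_left, hZ', inner_add_left]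
    field_simp
    ring

theorem isCovDeriv_unique (f : ℝ → ℝ) (c W : ℝ → ℝ × V) (s : ℝ) (hf0 : f (c s).1 ≠ 0)
    (D₁ D₂ : ℝ × V) (h₁ : IsCovDeriv (warpedMetric f) warpedTangent c W s D₁)
    (h₂ : IsCovDeriv (warpedMetric f) warpedTangent c W s D₂) : D₁ = D₂ := by
  have hm : D₁ - D₂ ∈ warpedTangent (c s) := Submodule.sub_mem _ h₁.1 h₂.1
  have ht : ((1 : ℝ), (0 : V)) ∈ warpedTangent (c s) := by
    change inner ℝ (c s).2 (0 : V) = 0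
    simp
  have hv : ((0 : ℝ), (D₁ - D₂).2) ∈ warpedTangent (c s) := hm
  have e1 := (h₁.2 _ ht).trans (h₂.2 _ ht).symm
  have e2 := (h₁.2 _ hv).trans (h₂.2 _ hv).symm
  simp only [warpedMetric, inner_zero_right, mul_zero, add_zero, mul_one, neg_inj] at e1
  simp only [warpedMetric, mul_zero, neg_zero, zero_add] at e2
  have e3 := mul_left_cancel₀ (pow_ne_zero 2 hf0) e2
  have e4 : (inner ℝ (D₁ - D₂).2 (D₁ - D₂).2 : ℝ) = 0 := by
    nth_rewrite 1 [Prod.snd_sub]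
    rw [inner_sub_left, e3, sub_self]
  exact Prod.ext e1 (sub_eq_zero.mp (inner_self_eq_zero.mp e4))

/-- Along curves in a warped product the covariant derivative exists and is unique, so that
`covDeriv` is that vector. -/
theorem existsUnique_isCovDeriv (f : ℝ → ℝ) (c W : ℝ → ℝ × V) (s : ℝ)
    (hf : DifferentiableAt ℝ f (c s).1) (hf0 : f (c s).1 ≠ 0) (hc : (c s).2 ≠ 0) :
    ∃! D, IsCovDeriv (warpedMetric f) warpedTangent c W s D :=
  ⟨_, isCovDeriv_warped f c W s hf hf0 hc _ rfl,
    fun _ hD => isCovDeriv_unique f c W s hf0 _ _ hD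
      (isCovDeriv_warped f c W s hf hf0 hc _ rfl)⟩

end Warped

/-! ## The Hopf map and the two warped products -/

/-- `ℂ²`, as a Euclidean space. -/
abbrev C2 := WithLp 2 (ℂ × ℂ)

/-- `ℂ × ℝ`, as a Euclidean space. -/
abbrev C1R := WithLp 2 (ℂ × ℝ)

/-- The closed FLRW spacetime `I ×_f S³`. -/
def closedFLRW (I : Set ℝ) : Set (ℝ × C2) := warpedProduct C2 I 1

/-- The toy model `I ×_f S²(1/2)`. -/
def toyModel (I : Set ℝ) : Set (ℝ × C1R) := warpedProduct C1R I (1 / 2)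

/-- The Hopf map `(z, w) ↦ (z w̄, |z|²/2 - |w|²/2)`. -/
def hopf (p : C2) : C1R :=
  WithLp.toLp 2 (p.fst * (starRingEnd ℂ) p.snd, (1 / 2) * ‖p.fst‖ ^ 2 - (1 / 2) * ‖p.snd‖ ^ 2)

/-- The projection `(t, p) ↦ (t, hopf p)` of `I ×_f S³` onto `I ×_f S²(1/2)`. -/
def hopfBar (p : ℝ × C2) : ℝ × C1R := (p.1, hopf p.2)

/-- Vertical vectors: vectors tangent to `I ×_f S³` in the kernel of the differential of the
projection. -/
def IsVertical (p X : ℝ × C2) : Prop := X ∈ warpedTangent p ∧ fderiv ℝ hopfBar p X = 0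

/-- Horizontal vectors: vectors tangent to `I ×_f S³` orthogonal to the vertical ones. -/
def IsHorizontal (f : ℝ → ℝ) (p X : ℝ × C2) : Prop :=
  X ∈ warpedTangent p ∧ ∀ Y, IsVertical p Y → warpedMetric f p X Y = 0

/-- `β` is a horizontal lift to `I ×_f S³` of the curve `α : J → I ×_f S²(1/2)`. -/
structure IsHorizontalLift (I : Set ℝ) (f : ℝ → ℝ) (J : Set ℝ) (α : ℝ → ℝ × C1R)
    (β : ℝ → ℝ × C2) : Prop where
  smooth : ContDiffOn ℝ ∞ β J
  mem : ∀ s ∈ J, β s ∈ closedFLRW I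
  lift : ∀ s ∈ J, hopfBar (β s) = α s
  horizontal : ∀ s ∈ J, IsHorizontal f (β s) (deriv β s)

/-- The action of `S¹` on `I ×_f S³`. -/
def circleAct (a : Circle) (p : ℝ × C2) : ℝ × C2 := (p.1, (a : ℂ) • p.2)

/-- The map `(s, a) ↦ a · β(s)`, which sweeps out the surface over `J × S¹`. -/
def hopfSurface (β : ℝ → ℝ × C2) (q : ℝ × Circle) : ℝ × C2 := circleAct q.2 (β q.1)

/-- `hopfSurface β` in the local coordinates `(s, θ) ↦ (s, e^{iθ})` of `J × S¹`. -/
def hopfSurfaceCoord (β : ℝ → ℝ × C2) (q : ℝ × ℝ) : ℝ × C2 :=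
  hopfSurface β (q.1, Circle.exp q.2)

/-! ## Frenet curves in the toy model -/

/-- The coordinates of a vector of `ℝ × (ℂ × ℝ) = ℝ⁴`. -/
def coords (X : ℝ × C1R) : Fin 4 → ℝ := ![X.1, X.2.fst.re, X.2.fst.im, X.2.snd]

/-- The tangent frame `(X, Y, Z)` of the toy model at `p` is positive. The orientation is the one
for which `(∂_t, Y, Z)` is positive whenever `(Y, Z)` is a positive frame of the sphere, and
`o` is the orientation of the sphere: `(Y, Z)` is positive if `o * det (p.2, Y, Z) > 0`. -/
def IsPositiveFrame (o : ℤˣ) (p X Y Z : ℝ × C1R) : Prop :=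
  0 < ((o : ℤ) : ℝ) *
    (Matrix.of ![coords X, coords ((0 : ℝ), p.2), coords Y, coords Z]).det

/-- `α : J → I ×_f S²(1/2)` is a unit spacelike Frenet curve, with Frenet frame `(α', N, B)`,
curvature `κ > 0`, torsion `τ` and causal signs `ε₂`, `ε₃` of `N`, `B`. -/
structure IsFrenetCurve (o : ℤˣ) (I : Set ℝ) (f : ℝ → ℝ) (J : Set ℝ) (α N B : ℝ → ℝ × C1R)
    (κ τ : ℝ → ℝ) (ε₂ ε₃ : ℝ) : Prop where
  smooth : ContDiffOn ℝ ∞ α J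
  mem : ∀ s ∈ J, α s ∈ toyModel I
  smooth_N : ContDiffOn ℝ ∞ N J
  smooth_B : ContDiffOn ℝ ∞ B J
  smooth_κ : ContDiffOn ℝ ∞ κ J
  smooth_τ : ContDiffOn ℝ ∞ τ J
  tangent_N : ∀ s ∈ J, N s ∈ warpedTangent (α s)
  tangent_B : ∀ s ∈ J, B s ∈ warpedTangent (α s)
  sign : ε₂ = 1 ∨ ε₂ = -1
  sign_eq : ε₂ = -ε₃
  unit : ∀ s ∈ J, warpedMetric f (α s) (deriv α s) (deriv α s) = 1
  inner_NN : ∀ s ∈ J, warpedMetric f (α s) (N s) (N s) = ε₂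
  inner_BB : ∀ s ∈ J, warpedMetric f (α s) (B s) (B s) = ε₃
  inner_TN : ∀ s ∈ J, warpedMetric f (α s) (deriv α s) (N s) = 0
  inner_TB : ∀ s ∈ J, warpedMetric f (α s) (deriv α s) (B s) = 0
  inner_NB : ∀ s ∈ J, warpedMetric f (α s) (N s) (B s) = 0
  positive : ∀ s ∈ J, IsPositiveFrame o (α s) (deriv α s) (N s) (B s)
  curvature_pos : ∀ s ∈ J, 0 < κ s
  frenet_T : ∀ s ∈ J, covDeriv (warpedMetric f) warpedTangent α (deriv α) s = (ε₂ * κ s) • N s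
  frenet_N : ∀ s ∈ J, covDeriv (warpedMetric f) warpedTangent α N s
    = -(κ s) • deriv α s + (ε₃ * τ s) • B s
  frenet_B : ∀ s ∈ J, covDeriv (warpedMetric f) warpedTangent α B s = -(ε₂ * τ s) • N s

end

end WarpedHopf

namespace WarpedHopf

noncomputable section

/-! ## Algebra of the Hopf map -/

/-! The Hopf projection is a semi-Riemannian submersion whose fibres are orbits of an isometric
circle action, so the mean curvature can be computed along `β` and read off downstairs. Write D for
the acceleration of `β`, V for the fibre velocity (of length f) and T = α'. Fibres are great circles
of the three-sphere, so the acceleration of a fibre is only the warping term f f' ∂_t. Hence 2H is,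
up to the circle action, the normal part of A = D + (f'/f) ∂_t. Both summands are horizontal, so
only the component along β' has to be removed, and 4 g(H, H) = g(A, A) - g(A, β')².

Both terms survive projection. D goes to the acceleration ε₂κN of `α` (`covDeriv_hopfBar`), ∂_t goes
to ∂_t, and products of horizontal vectors are preserved (`warpedMetric_hopfBarDeriv`). Expanding
∂_t in the Frenet frame (`dt_eq_of_frame`), the part of ε₂κN + (f'/f) ∂_t orthogonal to T is ε₂(κ +
(f'/f)⟨∂_t, N⟩)N + ε₃(f'/f)⟨∂_t, B⟩B, whose square is the expression in the theorem.

The submersion facts reduce to polynomial identities for the symmetric bilinear map q with hopf(p) =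
q(p, p): `inner_hopfBilin` at first order and `hopfBilin_self_of_horizontal` at second order. -/

theorem inner_C2 (u v : C2) :
    (inner ℝ u v : ℝ) = u.fst.re * v.fst.re + u.fst.im * v.fst.im
      + (u.snd.re * v.snd.re + u.snd.im * v.snd.im) := by
  rw [WithLp.prod_inner_apply]
  simp only [Complex.inner, Complex.mul_re, Complex.conj_re, Complex.conj_im, WithLp.ofLp_fst,
    WithLp.ofLp_snd]
  ring

theorem inner_C1R (u v : C1R) :
    (inner ℝ u v : ℝ) = u.fst.re * v.fst.re + u.fst.im * v.fst.im + u.snd * v.snd := by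
  rw [WithLp.prod_inner_apply]
  simp only [Complex.inner, Complex.mul_re, Complex.conj_re, Complex.conj_im, WithLp.ofLp_fst,
    WithLp.ofLp_snd, RCLike.inner_apply, conj_trivial]
  ring

/-- The symmetric bilinear map whose quadratic form is the Hopf map. -/
def hopfBilin : C2 →L[ℝ] C2 →L[ℝ] C1R :=
  LinearMap.toContinuousBilinearMap <| LinearMap.mk₂ ℝ
    (fun u v => WithLp.toLp 2
      ((1 / 2 : ℝ) • (u.fst * (starRingEnd ℂ) v.snd + v.fst * (starRingEnd ℂ) u.snd),
        (1 / 2) * (u.fst.re * v.fst.re + u.fst.im * v.fst.im)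
          - (1 / 2) * (u.snd.re * v.snd.re + u.snd.im * v.snd.im)))
    (fun u u' v => by
      refine WithLp.ofLp_injective _ (Prod.ext ?_ ?_)
      · simp; ring
      · simp; ring)
    (fun c u v => by
      refine WithLp.ofLp_injective _ (Prod.ext ?_ ?_)
      · simp; ring
      · simp; ring)
    (fun u v v' => by
      refine WithLp.ofLp_injective _ (Prod.ext ?_ ?_)
      · simp; ring
      · simp; ring)
    (fun c u v => by
      refine WithLp.ofLp_injective _ (Prod.ext ?_ ?_)
      · simp; ring
      · simp; ring)

theorem hopfBilin_apply (u v : C2) :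
    hopfBilin u v = WithLp.toLp 2
      ((1 / 2 : ℝ) • (u.fst * (starRingEnd ℂ) v.snd + v.fst * (starRingEnd ℂ) u.snd),
        (1 / 2) * (u.fst.re * v.fst.re + u.fst.im * v.fst.im)
          - (1 / 2) * (u.snd.re * v.snd.re + u.snd.im * v.snd.im)) := rfl

theorem hopfBilin_comm (u v : C2) : hopfBilin u v = hopfBilin v u := by
  rw [hopfBilin_apply, hopfBilin_apply]
  refine WithLp.ofLp_injective _ (Prod.ext ?_ ?_)
  · simp; ring
  · simp; ring

theorem hopf_eq_hopfBilin (p : C2) : hopf p = hopfBilin p p := by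
  rw [hopfBilin_apply, hopf]
  refine WithLp.ofLp_injective _ (Prod.ext ?_ ?_)
  · simp; ring
  · simp [← Complex.normSq_eq_norm_sq, Complex.normSq_apply]

theorem hasFDerivAt_hopf (p : C2) : HasFDerivAt hopf ((2 : ℝ) • hopfBilin p) p := by
  have h := hopfBilin.hasFDerivAt_of_bilinear (hasFDerivAt_id p) (hasFDerivAt_id p)
  have e : hopf = fun y => hopfBilin (id y) (id y) := funext hopf_eq_hopfBilin
  rw [e]
  refine h.congr_fderiv (ContinuousLinearMap.ext fun v => ?_)
  simp [two_smul, hopfBilin_comm v p]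

/-- The differential of the Hopf map at b is 2q(b, ·). For |b| = 1 this identity makes it isometric
on the orthogonal complement of the fibre direction ib, which it kills. -/
theorem inner_hopfBilin (b u v : C2) :
    (inner ℝ ((2 : ℝ) • hopfBilin b u) ((2 : ℝ) • hopfBilin b v) : ℝ)
      = inner ℝ b b * inner ℝ u v
        - inner ℝ (Complex.I • b) u * inner ℝ (Complex.I • b) v := by
  simp only [inner_C1R, inner_C2, hopfBilin_apply]
  simp
  ring

/-- A vector Hermitian-orthogonal to b is sent by the Hopf map to a multiple of the antipode of the
image of b. This makes the second-order term in the projected acceleration purely radial. -/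
theorem hopfBilin_self_of_horizontal (b u : C2) (hb : (inner ℝ b b : ℝ) = 1)
    (hu : (inner ℝ b u : ℝ) = 0) (hiu : (inner ℝ (Complex.I • b) u : ℝ) = 0) :
    hopfBilin u u = -(inner ℝ u u : ℝ) • hopfBilin b b := by
  simp only [inner_C2] at *
  simp only [WithLp.smul_fst, WithLp.smul_snd, smul_eq_mul, Complex.mul_re, Complex.mul_im,
    Complex.I_re, Complex.I_im, zero_mul, one_mul, zero_sub, zero_add] at hiu
  simp only [hopfBilin_apply]
  -- Each component is an instance of |b|² q(u,u) + |u|² q(b,b) = 2⟨b,u⟩ q(b,u) + 2⟨ib,u⟩ q(ib,u),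
  -- which gives the coefficients -q(u,u), 2q(b,u) and 2q(ib,u).
  refine WithLp.ofLp_injective _ (Prod.ext (Complex.ext ?_ ?_) ?_)
  · simp
    linear_combination
      (-(u.fst.re * u.snd.re + u.fst.im * u.snd.im)) * hb
      + (b.fst.re * u.snd.re + b.fst.im * u.snd.im + u.fst.re * b.snd.re + u.fst.im * b.snd.im) * hu
      + (-(b.fst.im * u.snd.re - b.fst.re * u.snd.im) + (u.fst.im * b.snd.re - u.fst.re * b.snd.im)) * hiu
  · simp
    linear_combination
      (-(u.fst.im * u.snd.re - u.fst.re * u.snd.im)) * hb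
      + (b.fst.im * u.snd.re - b.fst.re * u.snd.im + (u.fst.im * b.snd.re - u.fst.re * b.snd.im)) * hu
      + (b.fst.re * u.snd.re + b.fst.im * u.snd.im - (u.fst.re * b.snd.re + u.fst.im * b.snd.im)) * hiu
  · simp
    linear_combination
      (-(1 / 2) * (u.fst.re * u.fst.re + u.fst.im * u.fst.im - (u.snd.re * u.snd.re + u.snd.im * u.snd.im))) * hb
      + (b.fst.re * u.fst.re + b.fst.im * u.fst.im - (b.snd.re * u.snd.re + b.snd.im * u.snd.im)) * hu
      + (b.fst.re * u.fst.im - b.fst.im * u.fst.re - (b.snd.re * u.snd.im - b.snd.im * u.snd.re)) * hiu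

/-! ## The Hopf projection of a warped product is a semi-Riemannian submersion -/

/-- The differential of `hopfBar`. -/
def hopfBarDeriv (p : ℝ × C2) : ℝ × C2 →L[ℝ] ℝ × C1R :=
  (ContinuousLinearMap.fst ℝ ℝ C2).prod
    (((2 : ℝ) • hopfBilin p.2).comp (ContinuousLinearMap.snd ℝ ℝ C2))

theorem hopfBarDeriv_apply (p X : ℝ × C2) :
    hopfBarDeriv p X = (X.1, (2 : ℝ) • hopfBilin p.2 X.2) := rfl

theorem hasFDerivAt_hopfBar (p : ℝ × C2) : HasFDerivAt hopfBar (hopfBarDeriv p) p :=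
  hasFDerivAt_fst.prodMk ((hasFDerivAt_hopf p.2).comp p hasFDerivAt_snd)

theorem inner_I_smul_self (b : C2) : (inner ℝ (Complex.I • b) b : ℝ) = 0 := by
  rw [inner_C2]
  simp
  ring

theorem inner_I_smul_I_smul (u v : C2) :
    (inner ℝ (Complex.I • u) (Complex.I • v) : ℝ) = inner ℝ u v := by
  simp only [inner_C2]
  simp
  ring

theorem hopfBilin_I_smul (b : C2) : hopfBilin b (Complex.I • b) = 0 := by
  rw [hopfBilin_apply]
  refine WithLp.ofLp_injective _ (Prod.ext (Complex.ext ?_ ?_) ?_)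
  · simp
    ring
  · simp
    ring
  · simp
    ring

theorem inner_hopf_hopfBilin (b u : C2) :
    (inner ℝ (hopf b) ((2 : ℝ) • hopfBilin b u) : ℝ) = 1 / 2 * (inner ℝ b b * inner ℝ b u) := by
  have h : hopf b = (1 / 2 : ℝ) • ((2 : ℝ) • hopfBilin b b) := by
    rw [hopf_eq_hopfBilin, smul_smul]
    norm_num
  rw [h, real_inner_smul_left, inner_hopfBilin, inner_I_smul_self]
  ring

theorem inner_hopf_self (b : C2) :
    (inner ℝ (hopf b) (hopf b) : ℝ) = 1 / 4 * inner ℝ b b ^ 2 := by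
  have h := inner_hopf_hopfBilin b b
  rw [real_inner_smul_right, ← hopf_eq_hopfBilin] at h
  linear_combination 1 / 2 * h

theorem hopfBarDeriv_mem_warpedTangent {p X : ℝ × C2} (hX : X ∈ warpedTangent p) :
    hopfBarDeriv p X ∈ warpedTangent (hopfBar p) := by
  change inner ℝ (hopf p.2) ((2 : ℝ) • hopfBilin p.2 X.2) = (0 : ℝ)
  have h : (inner ℝ p.2 X.2 : ℝ) = 0 := hX
  rw [inner_hopf_hopfBilin, h, mul_zero, mul_zero]

theorem isVertical_I_smul (p : ℝ × C2) : IsVertical p (0, Complex.I • p.2) := by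
  refine ⟨(real_inner_comm _ _).trans (inner_I_smul_self p.2), ?_⟩
  rw [(hasFDerivAt_hopfBar p).fderiv, hopfBarDeriv_apply]
  simp [hopfBilin_I_smul]

/-- Testing against the single vertical vector ip suffices; that it spans the vertical space is
never needed. -/
theorem IsHorizontal.inner_eq_zero {f : ℝ → ℝ} {p X : ℝ × C2} (hf0 : f p.1 ≠ 0)
    (h : IsHorizontal f p X) : (inner ℝ (Complex.I • p.2) X.2 : ℝ) = 0 := by
  have h' := h.2 _ (isVertical_I_smul p)
  simp only [warpedMetric, mul_zero, neg_zero, zero_add] at h'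
  rw [real_inner_comm]
  exact (mul_eq_zero.mp h').resolve_left (pow_ne_zero 2 hf0)

/-- The defect in `inner_hopfBilin` is the product of the two fibre components, so horizontality of
one argument is enough. -/
theorem warpedMetric_hopfBarDeriv (f : ℝ → ℝ) (p X Y : ℝ × C2) (hp : (inner ℝ p.2 p.2 : ℝ) = 1)
    (hX : (inner ℝ (Complex.I • p.2) X.2 : ℝ) = 0) :
    warpedMetric f (hopfBar p) (hopfBarDeriv p X) (hopfBarDeriv p Y) = warpedMetric f p X Y := by
  simp only [warpedMetric, hopfBarDeriv_apply, hopfBar]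
  rw [inner_hopfBilin, hp, hX]
  ring

/-! ## Covariant derivatives in a warped product -/

theorem covDeriv_congr {E : Type*} [NormedAddCommGroup E] [NormedSpace ℝ E]
    {g : E → E → E → ℝ} {T : E → Submodule ℝ E} {c₁ c₂ W₁ W₂ : ℝ → E} {s : ℝ}
    (hc : c₁ =ᶠ[nhds s] c₂) (hW : W₁ =ᶠ[nhds s] W₂) :
    covDeriv g T c₁ W₁ s = covDeriv g T c₂ W₂ s := by
  have h : IsCovDeriv g T c₁ W₁ s = IsCovDeriv g T c₂ W₂ s := by
    funext D
    simp only [IsCovDeriv, hc.eq_of_nhds, hW.eq_of_nhds, hc.deriv_eq, hW.deriv_eq]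
  unfold covDeriv
  rw [h]

theorem covDeriv_eq {V : Type*} [NormedAddCommGroup V] [InnerProductSpace ℝ V] {f : ℝ → ℝ}
    {c W : ℝ → ℝ × V} {s : ℝ} {D : ℝ × V} (hf0 : f (c s).1 ≠ 0)
    (h : IsCovDeriv (warpedMetric f) warpedTangent c W s D) :
    covDeriv (warpedMetric f) warpedTangent c W s = D := by
  have hex : ∃ D, IsCovDeriv (warpedMetric f) warpedTangent c W s D := ⟨D, h⟩
  rw [covDeriv, dif_pos hex]
  exact isCovDeriv_unique f c W s hf0 _ _ hex.choose_spec h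

theorem covDeriv_warped {V : Type*} [NormedAddCommGroup V] [InnerProductSpace ℝ V]
    {f : ℝ → ℝ} {c W : ℝ → ℝ × V} {s : ℝ} {c' W' : ℝ × V}
    (hf : DifferentiableAt ℝ f (c s).1) (hf0 : f (c s).1 ≠ 0) (hc : (c s).2 ≠ 0)
    (hc' : HasDerivAt c c' s) (hW' : HasDerivAt W W' s) {Y : V}
    (hY : Y = W'.2 + (deriv f (c s).1 / f (c s).1) • (c'.1 • (W s).2 + (W s).1 • c'.2)) :
    covDeriv (warpedMetric f) warpedTangent c W s =
      (W'.1 + f (c s).1 * deriv f (c s).1 * inner ℝ c'.2 (W s).2,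
        Y - (inner ℝ (c s).2 Y / inner ℝ (c s).2 (c s).2 : ℝ) • (c s).2) := by
  have h := covDeriv_eq hf0 (isCovDeriv_warped f c W s hf hf0 hc Y
    (by rw [hc'.deriv, hW'.deriv]; exact hY))
  rwa [hc'.deriv, hW'.deriv] at h

/-- The acceleration of the projection of a horizontal curve is the projection of its
acceleration. -/
theorem covDeriv_hopfBar {f : ℝ → ℝ} {β : ℝ → ℝ × C2} {s : ℝ}
    (hf : DifferentiableAt ℝ f (β s).1) (hf0 : f (β s).1 ≠ 0)
    (hβ : ∀ᶠ u in nhds s, DifferentiableAt ℝ β u) (hβ' : DifferentiableAt ℝ (deriv β) s)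
    (hb : (inner ℝ (β s).2 (β s).2 : ℝ) = 1)
    (ht : (inner ℝ (β s).2 (deriv β s).2 : ℝ) = 0)
    (hh : (inner ℝ (Complex.I • (β s).2) (deriv β s).2 : ℝ) = 0) :
    covDeriv (warpedMetric f) warpedTangent (fun u => hopfBar (β u))
        (deriv fun u => hopfBar (β u)) s
      = hopfBarDeriv (β s) (covDeriv (warpedMetric f) warpedTangent β (deriv β) s) := by
  have hd : ∀ u, DifferentiableAt ℝ β u →
      HasDerivAt (fun u => hopfBar (β u)) (hopfBarDeriv (β u) (deriv β u)) u := fun u hu =>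
    (hasFDerivAt_hopfBar (β u)).comp_hasDerivAt u hu.hasDerivAt
  have hβs : HasDerivAt β (deriv β s) s := hβ.self_of_nhds.hasDerivAt
  have hββ : HasDerivAt (deriv β) (deriv (deriv β) s) s := hβ'.hasDerivAt
  have hev : (deriv fun u => hopfBar (β u)) =ᶠ[nhds s]
      fun u => ((deriv β u).1, (2 : ℝ) • hopfBilin (β u).2 (deriv β u).2) := by
    filter_upwards [hβ] with u hu using (hd u hu).deriv
  have hdd : HasDerivAt (deriv fun u => hopfBar (β u))
      ((deriv (deriv β) s).1, (2 : ℝ) • (hopfBilin (β s).2 (deriv (deriv β) s).2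
        + hopfBilin (deriv β s).2 (deriv β s).2)) s := by
    refine HasDerivAt.congr_of_eventuallyEq ?_ hev
    exact hββ.fst.prodMk ((ContinuousLinearMap.hasDerivAt_of_bilinear (B := hopfBilin)
      (fun _ => hβs.snd) (fun _ => hββ.snd)).const_smul (2 : ℝ))
  have hcc : (inner ℝ (hopf (β s).2) (hopf (β s).2) : ℝ) = 1 / 4 := by
    rw [inner_hopf_self, hb]
    norm_num
  have hb0 : (β s).2 ≠ 0 := fun h => by rw [h, inner_zero_left] at hb; exact zero_ne_one hb
  have hc0 : (hopf (β s).2) ≠ 0 := fun h => by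
    rw [h, inner_zero_left] at hcc; norm_num at hcc
  rw [covDeriv_warped hf hf0 hb0 hβs hββ rfl,
    covDeriv_warped (c := fun u => hopfBar (β u)) hf hf0 hc0 (hd s hβ.self_of_nhds) hdd rfl]
  rw [hev.self_of_nhds]
  simp only [hopfBarDeriv_apply]
  have hi1 : (inner ℝ ((2 : ℝ) • hopfBilin (β s).2 (deriv β s).2)
      ((2 : ℝ) • hopfBilin (β s).2 (deriv β s).2) : ℝ)
      = inner ℝ (deriv β s).2 (deriv β s).2 := by
    rw [inner_hopfBilin, hb, hh]
    ring
  -- Differentiating 2q(β, β') leaves the extra term 2q(β', β'). By `hq` it is a multiple of the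
  -- position vector, so projection onto the tangent space of the sphere removes it.
  have hq := hopfBilin_self_of_horizontal _ _ hb ht hh
  refine Prod.ext ?_ ?_
  · simp only [hopfBar, hi1]
  · simp only [hopfBar]
    set Y := (deriv (deriv β) s).2 + (deriv f (β s).1 / f (β s).1) •
      ((deriv β s).1 • (deriv β s).2 + (deriv β s).1 • (deriv β s).2) with hY
    have hY3 : (2 : ℝ) • (hopfBilin (β s).2 (deriv (deriv β) s).2
          + hopfBilin (deriv β s).2 (deriv β s).2)
        + (deriv f (β s).1 / f (β s).1) •
          ((deriv β s).1 • (2 : ℝ) • hopfBilin (β s).2 (deriv β s).2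
            + (deriv β s).1 • (2 : ℝ) • hopfBilin (β s).2 (deriv β s).2)
        = (2 : ℝ) • hopfBilin (β s).2 Y
          - (2 * inner ℝ (deriv β s).2 (deriv β s).2 : ℝ) • hopf (β s).2 := by
      rw [hq, hopf_eq_hopfBilin, hY]
      simp only [map_add, map_smul]
      module
    have hcY : (inner ℝ (hopf (β s).2) ((2 : ℝ) • hopfBilin (β s).2 Y) : ℝ)
        = 1 / 2 * inner ℝ (β s).2 Y := by
      rw [inner_hopf_hopfBilin, hb, one_mul]
    rw [hY3, inner_sub_right, hcY, real_inner_smul_right, hcc, hb, map_sub, map_smul,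
      ← hopf_eq_hopfBilin]
    module

/-! ## Bilinearity of the warped metric -/

section Bilinear

variable {V : Type*} [NormedAddCommGroup V] [InnerProductSpace ℝ V] (f : ℝ → ℝ)
  (p X Y Z : ℝ × V) (a : ℝ)

theorem warpedMetric_comm : warpedMetric f p X Y = warpedMetric f p Y X := by
  simp only [warpedMetric, real_inner_comm, mul_comm]

theorem warpedMetric_add_left :
    warpedMetric f p (X + Y) Z = warpedMetric f p X Z + warpedMetric f p Y Z := by
  simp only [warpedMetric, Prod.fst_add, Prod.snd_add, inner_add_left]
  ring

theorem warpedMetric_smul_left : warpedMetric f p (a • X) Y = a * warpedMetric f p X Y := by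
  simp only [warpedMetric, Prod.smul_fst, Prod.smul_snd, real_inner_smul_left, smul_eq_mul]
  ring

theorem warpedMetric_sub_left :
    warpedMetric f p (X - Y) Z = warpedMetric f p X Z - warpedMetric f p Y Z := by
  simp only [warpedMetric, Prod.fst_sub, Prod.snd_sub, inner_sub_left]
  ring

theorem warpedMetric_add_right :
    warpedMetric f p X (Y + Z) = warpedMetric f p X Y + warpedMetric f p X Z := by
  simp only [warpedMetric_comm f p X, warpedMetric_add_left]

theorem warpedMetric_smul_right : warpedMetric f p X (a • Y) = a * warpedMetric f p X Y := by
  simp only [warpedMetric_comm f p X, warpedMetric_smul_left]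

theorem warpedMetric_sub_right :
    warpedMetric f p X (Y - Z) = warpedMetric f p X Y - warpedMetric f p X Z := by
  simp only [warpedMetric_comm f p X, warpedMetric_sub_left]

end Bilinear

/-! ## The circle action -/

/-- `circleAct` as a continuous linear map. -/
def circleActL (a : Circle) : ℝ × C2 →L[ℝ] ℝ × C2 :=
  (ContinuousLinearMap.fst ℝ ℝ C2).prod ((a : ℂ) • ContinuousLinearMap.snd ℝ ℝ C2)

theorem circleActL_apply (a : Circle) (X : ℝ × C2) : circleActL a X = (X.1, (a : ℂ) • X.2) := rfl

theorem inner_circle_smul (a : Circle) (u v : C2) :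
    (inner ℝ ((a : ℂ) • u) ((a : ℂ) • v) : ℝ) = inner ℝ u v := by
  have ha : (a : ℂ).re * (a : ℂ).re + (a : ℂ).im * (a : ℂ).im = 1 := by
    rw [← Complex.normSq_apply, Circle.normSq_coe]
  simp only [inner_C2, WithLp.smul_fst, WithLp.smul_snd, smul_eq_mul, Complex.mul_re,
    Complex.mul_im]
  linear_combination (u.fst.re * v.fst.re + u.fst.im * v.fst.im
      + (u.snd.re * v.snd.re + u.snd.im * v.snd.im)) * ha

theorem warpedMetric_circleActL (f : ℝ → ℝ) (a : Circle) (p X Y : ℝ × C2) :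
    warpedMetric f (circleActL a p) (circleActL a X) (circleActL a Y) = warpedMetric f p X Y := by
  simp only [warpedMetric, circleActL_apply, inner_circle_smul]

/-- The circle acts by linear isometries that fix t, so it commutes with covariant differentiation.
The shift by s matches `secondForm`, whose curves are based at parameter 0. -/
theorem covDeriv_circleActL {f : ℝ → ℝ} {β W : ℝ → ℝ × C2} {s : ℝ} (a : Circle)
    (hf : DifferentiableAt ℝ f (β s).1) (hf0 : f (β s).1 ≠ 0) (hb : (β s).2 ≠ 0)
    (hβ : DifferentiableAt ℝ β s) (hW : DifferentiableAt ℝ W s)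
    {c U : ℝ → ℝ × C2} (hc : ∀ u, c u = circleActL a (β (s + u)))
    (hU : U =ᶠ[nhds 0] fun u => circleActL a (W (s + u))) :
    covDeriv (warpedMetric f) warpedTangent c U 0
      = circleActL a (covDeriv (warpedMetric f) warpedTangent β W s) := by
  have hβ0 : HasDerivAt β (deriv β s) (s + 0) := by simpa using hβ.hasDerivAt
  have hW0 : HasDerivAt W (deriv W s) (s + 0) := by simpa using hW.hasDerivAt
  have hcd : HasDerivAt c (circleActL a (deriv β s)) 0 := by
    rw [funext hc]
    exact (circleActL a).hasFDerivAt.comp_hasDerivAt 0 (hβ0.comp_const_add s 0)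
  have hUd : HasDerivAt U (circleActL a (deriv W s)) 0 := by
    refine HasDerivAt.congr_of_eventuallyEq ?_ hU
    exact (circleActL a).hasFDerivAt.comp_hasDerivAt 0 (hW0.comp_const_add s 0)
  have hc0 : c 0 = circleActL a (β s) := by rw [hc, add_zero]
  have hU0 : U 0 = circleActL a (W s) := by simpa using hU.self_of_nhds
  rw [covDeriv_warped hf hf0 hb hβ.hasDerivAt hW.hasDerivAt rfl,
    covDeriv_warped (by rwa [hc0]) (by rwa [hc0]) (by
      rw [hc0]
      exact smul_ne_zero (Circle.coe_ne_zero a) hb) hcd hUd rfl, hc0, hU0]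
  simp only [circleActL_apply, inner_circle_smul]
  have hY : (a : ℂ) • (deriv W s).2 + (deriv f (β s).1 / f (β s).1) •
        ((deriv β s).1 • (a : ℂ) • (W s).2 + (W s).1 • (a : ℂ) • (deriv β s).2)
      = (a : ℂ) • ((deriv W s).2 + (deriv f (β s).1 / f (β s).1) •
        ((deriv β s).1 • (W s).2 + (W s).1 • (deriv β s).2)) := by
    simp only [smul_add, smul_comm (a : ℂ) (_ : ℝ)]
  rw [hY, inner_circle_smul, smul_sub, smul_comm (a : ℂ) (_ : ℝ)]

/-! ## The surface swept out by a horizontal curve -/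

theorem hopfSurfaceCoord_apply (β : ℝ → ℝ × C2) (q : ℝ × ℝ) :
    hopfSurfaceCoord β q = circleActL (Circle.exp q.2) (β q.1) := rfl

theorem hasDerivAt_circle_exp (θ : ℝ) :
    HasDerivAt (fun u : ℝ => (Circle.exp u : ℂ)) (Complex.I * Circle.exp θ) θ := by
  simp only [Circle.coe_exp]
  have h := ((Complex.ofRealCLM.hasDerivAt (x := θ)).mul_const Complex.I).cexp
  simpa [mul_comm] using h

theorem hasFDerivAt_hopfSurfaceCoord {β : ℝ → ℝ × C2} {q : ℝ × ℝ}
    (hβ : DifferentiableAt ℝ β q.1) :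
    HasFDerivAt (hopfSurfaceCoord β)
      ((ContinuousLinearMap.fst ℝ ℝ ℝ).smulRight (circleActL (Circle.exp q.2) (deriv β q.1))
        + (ContinuousLinearMap.snd ℝ ℝ ℝ).smulRight
          ((0 : ℝ), Complex.I • (Circle.exp q.2 : ℂ) • (β q.1).2)) q := by
  have h1 : HasFDerivAt (fun q : ℝ × ℝ => β q.1) _ q :=
    hβ.hasDerivAt.hasFDerivAt.comp q hasFDerivAt_fst
  have h2 : HasFDerivAt (fun q : ℝ × ℝ => (Circle.exp q.2 : ℂ)) _ q :=
    (hasDerivAt_circle_exp q.2).hasFDerivAt.comp q hasFDerivAt_snd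
  refine (h1.fst.prodMk (h2.smul h1.snd)).congr_fderiv (ContinuousLinearMap.ext fun v => ?_)
  refine Prod.ext ?_ ?_
  · simp [circleActL_apply]
  · simp [-Circle.coe_exp, circleActL_apply, mul_smul]
    rw [smul_comm]

theorem fderiv_hopfSurfaceCoord {β : ℝ → ℝ × C2} {q : ℝ × ℝ} (hβ : DifferentiableAt ℝ β q.1)
    (v : ℝ × ℝ) : fderiv ℝ (hopfSurfaceCoord β) q v
      = v.1 • circleActL (Circle.exp q.2) (deriv β q.1)
        + v.2 • ((0 : ℝ), Complex.I • (Circle.exp q.2 : ℂ) • (β q.1).2) := by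
  rw [(hasFDerivAt_hopfSurfaceCoord hβ).fderiv]
  rfl

/-- A fibre is a great circle: its Euclidean acceleration is minus the position vector, which is
normal to the sphere. Only the warping term f f' |iβ|² ∂_t remains, with |iβ| = 1. -/
theorem covDeriv_fibre {f : ℝ → ℝ} {β : ℝ → ℝ × C2} {s : ℝ} (θ : ℝ)
    (hf : DifferentiableAt ℝ f (β s).1) (hf0 : f (β s).1 ≠ 0)
    (hb : (inner ℝ (β s).2 (β s).2 : ℝ) = 1) (hβ : DifferentiableAt ℝ β s) :
    covDeriv (warpedMetric f) warpedTangent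
        (fun u : ℝ => hopfSurfaceCoord β ((s, θ) + u • (0, 1)))
        (fun u : ℝ => fderiv ℝ (hopfSurfaceCoord β) ((s, θ) + u • (0, 1)) (0, 1)) 0
      = (f (β s).1 * deriv f (β s).1) • dt := by
  have hb0 : (β s).2 ≠ 0 := fun h => by rw [h, inner_zero_left] at hb; exact zero_ne_one hb
  have hc : (fun u : ℝ => hopfSurfaceCoord β ((s, θ) + u • (0, 1)))
      = fun u => ((β s).1, (Circle.exp (θ + u) : ℂ) • (β s).2) := by
    funext u
    simp [hopfSurfaceCoord_apply, circleActL_apply]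
  have hW : (fun u : ℝ => fderiv ℝ (hopfSurfaceCoord β) ((s, θ) + u • (0, 1)) (0, 1))
      = fun u => ((0 : ℝ), Complex.I • (Circle.exp (θ + u) : ℂ) • (β s).2) := by
    funext u
    rw [fderiv_hopfSurfaceCoord (by simpa using hβ)]
    simp
  have he : HasDerivAt (fun u : ℝ => (Circle.exp (θ + u) : ℂ)) (Complex.I * Circle.exp θ) 0 := by
    have h : HasDerivAt (fun u : ℝ => (Circle.exp u : ℂ)) (Complex.I * Circle.exp θ) (θ + 0) := by
      simpa using hasDerivAt_circle_exp θ
    exact h.comp_const_add θ 0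
  have hcd : HasDerivAt (fun u : ℝ => ((β s).1, (Circle.exp (θ + u) : ℂ) • (β s).2))
      ((0 : ℝ), (Complex.I * Circle.exp θ) • (β s).2) 0 :=
    (hasDerivAt_const (0 : ℝ) (β s).1).prodMk (he.smul_const (β s).2)
  have hWd : HasDerivAt
      (fun u : ℝ => ((0 : ℝ), Complex.I • (Circle.exp (θ + u) : ℂ) • (β s).2))
      ((0 : ℝ), Complex.I • (Complex.I * Circle.exp θ) • (β s).2) 0 :=
    (hasDerivAt_const (0 : ℝ) (0 : ℝ)).prodMk ((he.smul_const (β s).2).const_smul Complex.I)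
  have hii : Complex.I • Complex.I • (Circle.exp θ : ℂ) • (β s).2
      = -((Circle.exp θ : ℂ) • (β s).2) := by
    rw [smul_smul, Complex.I_mul_I, neg_smul, one_smul]
  rw [hc, hW, covDeriv_warped (by exact hf) (by exact hf0) (by
    exact smul_ne_zero (Circle.coe_ne_zero _) hb0) hcd hWd rfl]
  simp only [mul_smul Complex.I, hii, add_zero, zero_smul, smul_zero, inner_I_smul_I_smul,
    inner_neg_right, inner_circle_smul, hb]
  refine Prod.ext ?_ ?_
  · simp [dt]
  · simp [-Circle.coe_exp, dt]

theorem inv_diagonal_one {r : ℝ} (hr : r ≠ 0) :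
    (Matrix.diagonal ![1, r])⁻¹ = Matrix.diagonal ![1, r⁻¹] := by
  refine Matrix.inv_eq_right_inv ?_
  rw [Matrix.diagonal_mul_diagonal, ← Matrix.diagonal_one]
  congr 1
  funext i
  fin_cases i <;> simp [hr]

theorem meanCurvature_of_orthogonal {E : Type*} [NormedAddCommGroup E] [NormedSpace ℝ E]
    {g : E → E → E → ℝ} {T : E → Submodule ℝ E} {x : ℝ × ℝ → E} {q : ℝ × ℝ} {r : ℝ} (hr : r ≠ 0)
    (h : firstForm g x q = Matrix.diagonal ![1, r]) :
    meanCurvature g T x q = (1 / 2 : ℝ) •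
      (secondForm g T x q (1, 0) (1, 0) + r⁻¹ • secondForm g T x q (0, 1) (0, 1)) := by
  simp [meanCurvature, h, inv_diagonal_one hr, Fin.sum_univ_two, coordVec]

theorem normalPart_of_orthogonal {E : Type*} [NormedAddCommGroup E] [NormedSpace ℝ E]
    {g : E → E → E → ℝ} {x : ℝ × ℝ → E} {q : ℝ × ℝ} {r : ℝ} (hr : r ≠ 0)
    (h : firstForm g x q = Matrix.diagonal ![1, r]) (X : E) :
    normalPart g x q X = X - g (x q) X (fderiv ℝ x q (1, 0)) • fderiv ℝ x q (1, 0)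
      - (r⁻¹ * g (x q) X (fderiv ℝ x q (0, 1))) • fderiv ℝ x q (0, 1) := by
  simp [normalPart, h, inv_diagonal_one hr, Fin.sum_univ_two, coordVec, sub_sub]

/-- The data of a unit horizontal curve at one point. -/
structure IsUnitHorizontalAt (f : ℝ → ℝ) (β : ℝ → ℝ × C2) (s : ℝ) : Prop where
  norm_one : (inner ℝ (β s).2 (β s).2 : ℝ) = 1
  tangent : (inner ℝ (β s).2 (deriv β s).2 : ℝ) = 0
  horizontal : (inner ℝ (Complex.I • (β s).2) (deriv β s).2 : ℝ) = 0
  unit : warpedMetric f (β s) (deriv β s) (deriv β s) = 1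

theorem fderiv_hopfSurfaceCoord_fst {β : ℝ → ℝ × C2} {s : ℝ} (θ : ℝ)
    (hβ : DifferentiableAt ℝ β s) : fderiv ℝ (hopfSurfaceCoord β) (s, θ) (1, 0)
      = circleActL (Circle.exp θ) (deriv β s) := by
  rw [fderiv_hopfSurfaceCoord hβ]
  simp

theorem fderiv_hopfSurfaceCoord_snd {β : ℝ → ℝ × C2} {s : ℝ} (θ : ℝ)
    (hβ : DifferentiableAt ℝ β s) : fderiv ℝ (hopfSurfaceCoord β) (s, θ) (0, 1)
      = circleActL (Circle.exp θ) (0, Complex.I • (β s).2) := by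
  rw [fderiv_hopfSurfaceCoord hβ]
  simp [-Circle.coe_exp, circleActL_apply, smul_comm Complex.I]

theorem firstForm_hopfSurfaceCoord {f : ℝ → ℝ} {β : ℝ → ℝ × C2} {s : ℝ} (θ : ℝ)
    (hβ : DifferentiableAt ℝ β s) (h : IsUnitHorizontalAt f β s) :
    firstForm (warpedMetric f) (hopfSurfaceCoord β) (s, θ)
      = Matrix.diagonal ![1, f (β s).1 ^ 2] := by
  have h0 := fderiv_hopfSurfaceCoord_fst θ hβ
  have h1 := fderiv_hopfSurfaceCoord_snd θ hβ
  have h01 : warpedMetric f (β s) (deriv β s) (0, Complex.I • (β s).2) = 0 := by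
    simp only [warpedMetric]
    rw [real_inner_comm, h.horizontal]
    ring
  have h11 : warpedMetric f (β s) (0, Complex.I • (β s).2) (0, Complex.I • (β s).2)
      = f (β s).1 ^ 2 := by
    simp only [warpedMetric]
    rw [inner_I_smul_I_smul, h.norm_one]
    ring
  ext i j
  fin_cases i <;> fin_cases j <;>
    simp [firstForm, coordVec, h0, h1, hopfSurfaceCoord_apply, warpedMetric_circleActL, h.unit,
      h01, h11, warpedMetric_comm f (β s) (0, Complex.I • (β s).2) (deriv β s)]

theorem posDef_hopfSurfaceCoord {f : ℝ → ℝ} {β : ℝ → ℝ × C2} {s : ℝ} (θ : ℝ)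
    (hβ : DifferentiableAt ℝ β s) (hf0 : f (β s).1 ≠ 0) (h : IsUnitHorizontalAt f β s)
    {v : ℝ × ℝ} (hv : v ≠ 0) :
    0 < warpedMetric f (hopfSurfaceCoord β (s, θ)) (fderiv ℝ (hopfSurfaceCoord β) (s, θ) v)
      (fderiv ℝ (hopfSurfaceCoord β) (s, θ) v) := by
  have hF := firstForm_hopfSurfaceCoord θ hβ h
  have h00 := congrFun (congrFun hF 0) 0
  have h01 := congrFun (congrFun hF 0) 1
  have h11 := congrFun (congrFun hF 1) 1
  simp [firstForm, coordVec] at h00 h01 h11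
  have hv' : v = v.1 • (1, 0) + v.2 • (0, 1) := by simp
  have hsum : warpedMetric f (hopfSurfaceCoord β (s, θ))
      (fderiv ℝ (hopfSurfaceCoord β) (s, θ) v) (fderiv ℝ (hopfSurfaceCoord β) (s, θ) v)
      = v.1 ^ 2 + (f (β s).1 * v.2) ^ 2 := by
    rw [hv', map_add, map_smul, map_smul]
    simp only [warpedMetric_add_left, warpedMetric_smul_left, warpedMetric_add_right,
      warpedMetric_smul_right, h00, h01, h11,
      warpedMetric_comm f _ (fderiv ℝ (hopfSurfaceCoord β) (s, θ) (0, 1))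
        (fderiv ℝ (hopfSurfaceCoord β) (s, θ) (1, 0))]
    simp
    ring
  rw [hsum]
  by_cases h1 : v.1 = 0
  · have h2 : v.2 ≠ 0 := fun h2 => hv (Prod.ext h1 h2)
    have := mul_ne_zero hf0 h2
    positivity
  · positivity

/-- Differentiating ⟨iβ, β'⟩ = 0 gives ⟨iβ, β''⟩ = 0, because ⟨iβ', β'⟩ = 0. The other terms of the
acceleration are multiples of β' and β, both orthogonal to iβ. -/
theorem covDeriv_horizontal {f : ℝ → ℝ} {β : ℝ → ℝ × C2} {s : ℝ}
    (hf : DifferentiableAt ℝ f (β s).1) (hf0 : f (β s).1 ≠ 0)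
    (hβ : DifferentiableAt ℝ β s) (hβ' : DifferentiableAt ℝ (deriv β) s)
    (h : ∀ᶠ u in nhds s, IsUnitHorizontalAt f β u) :
    (inner ℝ (Complex.I • (β s).2)
      (covDeriv (warpedMetric f) warpedTangent β (deriv β) s).2 : ℝ) = 0 := by
  have h0 := h.self_of_nhds
  have hb0 : (β s).2 ≠ 0 := fun hb => by
    have := h0.norm_one
    rw [hb, inner_zero_left] at this
    exact zero_ne_one this
  have hd : HasDerivAt (fun u => (inner ℝ (Complex.I • (β u).2) (deriv β u).2 : ℝ))
      (inner ℝ (Complex.I • (β s).2) (deriv (deriv β) s).2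
        + inner ℝ (Complex.I • (deriv β s).2) (deriv β s).2) s := by
    have h1 : HasDerivAt (fun u => (β u).2) (deriv β s).2 s := hβ.hasDerivAt.snd
    have h2 : HasDerivAt (fun u => (deriv β u).2) (deriv (deriv β) s).2 s := hβ'.hasDerivAt.snd
    exact (h1.const_smul Complex.I).inner ℝ h2
  have hz : (fun u => (inner ℝ (Complex.I • (β u).2) (deriv β u).2 : ℝ)) =ᶠ[nhds s]
      fun _ => (0 : ℝ) := by
    filter_upwards [h] with u hu using hu.horizontal
  have h2 := hd.unique ((hasDerivAt_const s (0 : ℝ)).congr_of_eventuallyEq hz)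
  rw [inner_I_smul_self, add_zero] at h2
  rw [covDeriv_warped hf hf0 hb0 hβ.hasDerivAt hβ'.hasDerivAt rfl]
  simp only [inner_sub_right, inner_add_right, inner_smul_right, h2, h0.horizontal,
    inner_I_smul_self]
  ring

/-- With first form diag(1, f²) the trace is the normal part of D + f⁻²(f f' ∂_t). Everything is
carried back to the point of `β` by the circle action, and the fibre component vanishes since A is
horizontal. -/
theorem meanCurvature_hopfSurfaceCoord {f : ℝ → ℝ} {β : ℝ → ℝ × C2} {s : ℝ} (θ : ℝ)
    (hf : DifferentiableAt ℝ f (β s).1) (hf0 : f (β s).1 ≠ 0)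
    (hβ : ∀ᶠ u in nhds s, DifferentiableAt ℝ β u) (hβ' : DifferentiableAt ℝ (deriv β) s)
    (h : ∀ᶠ u in nhds s, IsUnitHorizontalAt f β u) {A : ℝ × C2}
    (hA : A = covDeriv (warpedMetric f) warpedTangent β (deriv β) s
      + (deriv f (β s).1 / f (β s).1) • dt) :
    meanCurvature (warpedMetric f) warpedTangent (hopfSurfaceCoord β) (s, θ)
      = (1 / 2 : ℝ) • circleActL (Circle.exp θ)
        (A - warpedMetric f (β s) A (deriv β s) • deriv β s) := by
  have h0 := h.self_of_nhds
  have hβs := hβ.self_of_nhds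
  have hb0 : (β s).2 ≠ 0 := fun hb => by
    have := h0.norm_one
    rw [hb, inner_zero_left] at this
    exact zero_ne_one this
  have hF := firstForm_hopfSurfaceCoord θ hβs h0
  have hr : f (β s).1 ^ 2 ≠ 0 := pow_ne_zero 2 hf0
  have hx0 := fderiv_hopfSurfaceCoord_fst θ hβs
  have hx1 := fderiv_hopfSurfaceCoord_snd θ hβs
  have hc0 := covDeriv_circleActL (Circle.exp θ) hf hf0 hb0 hβs hβ'
    (c := fun u : ℝ => hopfSurfaceCoord β ((s, θ) + u • (1, 0)))
    (U := fun u : ℝ => fderiv ℝ (hopfSurfaceCoord β) ((s, θ) + u • (1, 0)) (1, 0))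
    (fun u => by simp [hopfSurfaceCoord_apply]) (by
      have ht : Filter.Tendsto (fun u : ℝ => s + u) (nhds 0) (nhds s) := by
        have := (continuous_const_add s).tendsto (0 : ℝ)
        rwa [add_zero] at this
      filter_upwards [ht.eventually hβ] with u hu
      rw [fderiv_hopfSurfaceCoord (by simpa using hu)]
      simp)
  have hc1 := covDeriv_fibre θ hf hf0 h0.norm_one hβs
  have hdt : ∀ a : Circle, circleActL a dt = dt := fun a => by simp [circleActL_apply, dt]
  have hD := covDeriv_horizontal hf hf0 hβs hβ' h
  have hvert : ∀ X : ℝ × C2, (inner ℝ (Complex.I • (β s).2) X.2 : ℝ) = 0 →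
      warpedMetric f (β s) X (0, Complex.I • (β s).2) = 0 := fun X hX => by
    simp only [warpedMetric]
    rw [real_inner_comm, hX]
    ring
  have hdt0 : (inner ℝ (Complex.I • (β s).2) (dt : ℝ × C2).2 : ℝ) = 0 := by simp [dt]
  have hnormal : ∀ X : ℝ × C2, (inner ℝ (Complex.I • (β s).2) X.2 : ℝ) = 0 →
      normalPart (warpedMetric f) (hopfSurfaceCoord β) (s, θ) (circleActL (Circle.exp θ) X)
        = circleActL (Circle.exp θ) (X - warpedMetric f (β s) X (deriv β s) • deriv β s) :=
    fun X hX => by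
      rw [normalPart_of_orthogonal hr hF, hx0, hx1, hopfSurfaceCoord_apply,
        warpedMetric_circleActL, warpedMetric_circleActL, hvert X hX]
      simp only [mul_zero, zero_smul, sub_zero, map_sub, map_smul]
  rw [meanCurvature_of_orthogonal hr hF, secondForm, secondForm, hc0, hc1, hnormal _ hD,
    -- The action fixes ∂_t, so ∂_t can be written as an image under it and `hnormal` applies to
    -- both terms.
    ← hdt (Circle.exp θ), ← map_smul, hnormal _ (by
      rw [Prod.smul_snd, real_inner_smul_right, hdt0, mul_zero]), ← map_smul, ← map_add, hA]
  congr 2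
  simp only [warpedMetric_add_left, warpedMetric_smul_left]
  have hfr : (f (β s).1 ^ 2)⁻¹ * (f (β s).1 * deriv f (β s).1)
      = deriv f (β s).1 / f (β s).1 := by
    field_simp
  rw [← hfr]
  module

/-- The expansion of `∂_t` in an orthonormal frame of the toy model. -/
theorem dt_eq_of_frame {o : ℤˣ} {f : ℝ → ℝ} {p X Y Z : ℝ × C1R} {ε₂ ε₃ : ℝ} (hf0 : f p.1 ≠ 0)
    (hε₂ : ε₂ * ε₂ = 1) (hε₃ : ε₃ * ε₃ = 1)
    (hX : X ∈ warpedTangent p) (hY : Y ∈ warpedTangent p) (hZ : Z ∈ warpedTangent p)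
    (hpos : IsPositiveFrame o p X Y Z)
    (hXX : warpedMetric f p X X = 1) (hYY : warpedMetric f p Y Y = ε₂)
    (hZZ : warpedMetric f p Z Z = ε₃) (hXY : warpedMetric f p X Y = 0)
    (hXZ : warpedMetric f p X Z = 0) (hYZ : warpedMetric f p Y Z = 0) :
    dt = warpedMetric f p dt X • X + (ε₂ * warpedMetric f p dt Y) • Y
      + (ε₃ * warpedMetric f p dt Z) • Z := by
  set R : ℝ × C1R := dt - (warpedMetric f p dt X • X + (ε₂ * warpedMetric f p dt Y) • Y
      + (ε₃ * warpedMetric f p dt Z) • Z) with hR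
  have hRT : R ∈ warpedTangent p := by
    refine Submodule.sub_mem _ ?_ (Submodule.add_mem _ (Submodule.add_mem _
      (Submodule.smul_mem _ _ hX) (Submodule.smul_mem _ _ hY)) (Submodule.smul_mem _ _ hZ))
    change inner ℝ p.2 (0 : C1R) = (0 : ℝ)
    exact inner_zero_right _
  have hRX : warpedMetric f p X R = 0 := by
    rw [warpedMetric_comm, hR]
    simp only [warpedMetric_sub_left, warpedMetric_add_left, warpedMetric_smul_left,
      warpedMetric_comm f p Y X, warpedMetric_comm f p Z X, hXX, hXY, hXZ]
    ring
  have hRY : warpedMetric f p Y R = 0 := by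
    rw [warpedMetric_comm, hR]
    simp only [warpedMetric_sub_left, warpedMetric_add_left, warpedMetric_smul_left,
      warpedMetric_comm f p Z Y, hYY, hXY, hYZ]
    linear_combination (-warpedMetric f p dt Y) * hε₂
  have hRZ : warpedMetric f p Z R = 0 := by
    rw [warpedMetric_comm, hR]
    simp only [warpedMetric_sub_left, warpedMetric_add_left, warpedMetric_smul_left,
      hZZ, hXZ, hYZ]
    linear_combination (-warpedMetric f p dt Z) * hε₃
  -- Positivity of the frame serves only to make it, together with the position vector, a basis of
  -- ℝ⁴.
  have hdet : (Matrix.of ![coords X, coords ((0 : ℝ), p.2), coords Y, coords Z]).det ≠ 0 :=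
    (mul_ne_zero_iff.mp hpos.ne').2
  have hRp : (inner ℝ p.2 R.2 : ℝ) = 0 := hRT
  -- The vector is the remainder R with its index lowered by the metric. The rows pair it to g(X,
  -- R), f²⟨p, R⟩, g(Y, R) and g(Z, R), all zero.
  have hv := Matrix.eq_zero_of_mulVec_eq_zero hdet
    (v := ![-R.1, f p.1 ^ 2 * R.2.fst.re, f p.1 ^ 2 * R.2.fst.im, f p.1 ^ 2 * R.2.snd]) (by
      simp only [warpedMetric, inner_C1R] at hRX hRY hRZ hRp
      funext i
      fin_cases i
      · simp [Matrix.mulVec, dotProduct, Fin.sum_univ_four, coords]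
        linear_combination hRX
      · simp [Matrix.mulVec, dotProduct, Fin.sum_univ_four, coords]
        linear_combination (f p.1 ^ 2) * hRp
      · simp [Matrix.mulVec, dotProduct, Fin.sum_univ_four, coords]
        linear_combination hRY
      · simp [Matrix.mulVec, dotProduct, Fin.sum_univ_four, coords]
        linear_combination hRZ)
  have hf2 : f p.1 ^ 2 ≠ 0 := pow_ne_zero 2 hf0
  have e0 : R.1 = 0 := by simpa using congrFun hv 0
  have e1 : R.2.fst.re = 0 := by simpa [hf0] using congrFun hv 1
  have e2 : R.2.fst.im = 0 := by simpa [hf0] using congrFun hv 2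
  have e3 : R.2.snd = 0 := by simpa [hf0] using congrFun hv 3
  have hR0 : R = 0 := Prod.ext e0
    (WithLp.ofLp_injective _ (Prod.ext (Complex.ext e1 e2) e3))
  exact sub_eq_zero.mp hR0

end

end WarpedHopf

/-! ### Causal character of the mean curvature vector -/

open WarpedHopf in
theorem mainTheorem4
    (I : Set ℝ) (hI : IsOpen I) (hI' : I.OrdConnected)
    (f : ℝ → ℝ) (hf : ContDiffOn ℝ ∞ f I) (hfpos : ∀ t ∈ I, 0 < f t)
    (J : Set ℝ) (hJ : IsOpen J) (hJ' : J.OrdConnected)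
    (o : ℤˣ) (α N B : ℝ → ℝ × WarpedHopf.C1R) (κ τ : ℝ → ℝ) (ε₂ ε₃ : ℝ)
    (hα : WarpedHopf.IsFrenetCurve o I f J α N B κ τ ε₂ ε₃)
    (β : ℝ → ℝ × WarpedHopf.C2) (hβ : WarpedHopf.IsHorizontalLift I f J α β) :
    WarpedHopf.IsSpacelikeImmersion (WarpedHopf.warpedMetric f) (WarpedHopf.closedFLRW I)
      (WarpedHopf.hopfSurfaceCoord β) (J ×ˢ Set.univ) ∧
    ∀ s ∈ J, ∀ θ : ℝ,
      let P := WarpedHopf.hopfSurface β (s, Circle.exp θ)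
      let H := WarpedHopf.meanCurvature (WarpedHopf.warpedMetric f) WarpedHopf.warpedTangent
        (WarpedHopf.hopfSurfaceCoord β) (s, θ)
      let Q := ε₂ * (κ s + deriv f (α s).1 / f (α s).1
            * WarpedHopf.warpedMetric f (α s) WarpedHopf.dt (N s)) ^ 2
          + ε₃ * (deriv f (α s).1 / f (α s).1
            * WarpedHopf.warpedMetric f (α s) WarpedHopf.dt (B s)) ^ 2
      (WarpedHopf.IsSpacelike (WarpedHopf.warpedMetric f) P H ↔ 0 < Q) ∧
      (WarpedHopf.IsLightlike (WarpedHopf.warpedMetric f) P H ∨ H = 0 ↔ Q = 0) ∧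
      (WarpedHopf.IsTimelike (WarpedHopf.warpedMetric f) P H ↔ Q < 0) := by
  have hmem : ∀ s ∈ J, (β s).1 ∈ I := fun s hs => (hβ.mem s hs).1
  have hfne : ∀ s ∈ J, f (β s).1 ≠ 0 := fun s hs => (hfpos _ (hmem s hs)).ne'
  have hfd : ∀ s ∈ J, DifferentiableAt ℝ f (β s).1 := fun s hs =>
    (hf.contDiffAt (hI.mem_nhds (hmem s hs))).differentiableAt (by simp)
  have hβat : ∀ s ∈ J, ContDiffAt ℝ ∞ β s := fun s hs =>
    hβ.smooth.contDiffAt (hJ.mem_nhds hs)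
  have hβd : ∀ s ∈ J, DifferentiableAt ℝ β s := fun s hs =>
    (hβat s hs).differentiableAt (by simp)
  have hβdd : ∀ s ∈ J, DifferentiableAt ℝ (deriv β) s := fun s hs =>
    ((hβ.smooth.deriv_of_isOpen (m := 1) hJ (by decide)).contDiffAt
      (hJ.mem_nhds hs)).differentiableAt (by simp)
  have hαβ : ∀ s ∈ J, α =ᶠ[nhds s] fun u => hopfBar (β u) := fun s hs => by
    filter_upwards [hJ.mem_nhds hs] with u hu using (hβ.lift u hu).symm
  have hα' : ∀ s ∈ J, deriv α s = hopfBarDeriv (β s) (deriv β s) := fun s hs => by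
    rw [(hαβ s hs).deriv_eq]
    exact ((hasFDerivAt_hopfBar (β s)).comp_hasDerivAt s (hβd s hs).hasDerivAt).deriv
  have hnorm : ∀ s ∈ J, (inner ℝ (β s).2 (β s).2 : ℝ) = 1 := fun s hs => by
    rw [real_inner_self_eq_norm_sq, mem_sphere_zero_iff_norm.mp (hβ.mem s hs).2, one_pow]
  have hhor : ∀ s ∈ J, (inner ℝ (Complex.I • (β s).2) (deriv β s).2 : ℝ) = 0 := fun s hs =>
    (hβ.horizontal s hs).inner_eq_zero (hfne s hs)
  have hunit : ∀ s ∈ J, IsUnitHorizontalAt f β s := fun s hs =>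
    ⟨hnorm s hs, (hβ.horizontal s hs).1, hhor s hs, by
      rw [← warpedMetric_hopfBarDeriv f _ _ _ (hnorm s hs) (hhor s hs), ← hα' s hs,
        hβ.lift s hs]
      exact hα.unit s hs⟩
  refine ⟨⟨?_, ?_, ?_⟩, ?_⟩
  · have h1 : ContDiffOn ℝ ∞ (fun q : ℝ × ℝ => β q.1) (J ×ˢ Set.univ) :=
      hβ.smooth.comp contDiffOn_fst fun q hq => hq.1
    have h2 : ContDiff ℝ ∞ (fun q : ℝ × ℝ => (Circle.exp q.2 : ℂ)) := by
      simp only [Circle.coe_exp]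
      exact ((Complex.ofRealCLM.contDiff.comp contDiff_snd).mul contDiff_const).cexp
    exact h1.fst.prodMk (h2.contDiffOn.smul h1.snd)
  · rintro ⟨s, θ⟩ ⟨hs, -⟩
    refine ⟨hmem s hs, ?_⟩
    rw [mem_sphere_zero_iff_norm, hopfSurfaceCoord_apply, circleActL_apply, norm_smul,
      Circle.norm_coe, one_mul]
    exact mem_sphere_zero_iff_norm.mp (hβ.mem s hs).2
  · rintro ⟨s, θ⟩ ⟨hs, -⟩ v hv
    exact posDef_hopfSurfaceCoord θ (hβd s hs) (hfne s hs) (hunit s hs) hv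
  intro s hs θ P H Q
  -- The 4 cancels the square of the factor 1/2 in H; all three equivalences follow from this
  -- equality.
  have hH : 4 * warpedMetric f P H H = Q := by
    have hJs := hJ.mem_nhds hs
    have hf0 := hfne s hs
    have hεε : ε₂ * ε₂ = 1 ∧ ε₃ * ε₃ = 1 := by
      have h3 : ε₃ = -ε₂ := by rw [hα.sign_eq, neg_neg]
      rcases hα.sign with h | h <;> rw [h3, h] <;> norm_num
    have hevd : ∀ᶠ u in nhds s, DifferentiableAt ℝ β u := by
      filter_upwards [hJs] with u hu using hβd u hu
    have hevu : ∀ᶠ u in nhds s, IsUnitHorizontalAt f β u := by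
      filter_upwards [hJs] with u hu using hunit u hu
    set D := covDeriv (warpedMetric f) warpedTangent β (deriv β) s with hD
    set r := deriv f (β s).1 / f (β s).1 with hr
    set A : ℝ × C2 := D + r • dt with hA
    have hHA : H = (1 / 2 : ℝ) • circleActL (Circle.exp θ)
        (A - warpedMetric f (β s) A (deriv β s) • deriv β s) :=
      meanCurvature_hopfSurfaceCoord θ (hfd s hs) hf0 hevd (hβdd s hs) hevu rfl
    have hP : P = circleActL (Circle.exp θ) (β s) := rfl
    have hAh : (inner ℝ (Complex.I • (β s).2) A.2 : ℝ) = 0 := by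
      simp [hA, dt, hD, covDeriv_horizontal (hfd s hs) hf0 (hβd s hs) (hβdd s hs) hevu]
    have hN : hopfBarDeriv (β s) D = (ε₂ * κ s) • N s := by
      rw [← hα.frenet_T s hs, hD, ← covDeriv_hopfBar (hfd s hs) hf0 hevd (hβdd s hs)
        (hnorm s hs) (hunit s hs).tangent (hhor s hs)]
      exact (covDeriv_congr (hαβ s hs) (hαβ s hs).deriv).symm
    have hA3 : hopfBarDeriv (β s) A = (ε₂ * κ s) • N s + r • dt := by
      rw [hA, map_add, map_smul, hN]
      congr 2
      simp [hopfBarDeriv_apply, dt]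
    -- Only g(A, A) and g(A, β') enter g(H, H), and both can be evaluated in the toy model because A
    -- is horizontal.
    have hAA := warpedMetric_hopfBarDeriv f (β s) A A (hnorm s hs) hAh
    have hAT := warpedMetric_hopfBarDeriv f (β s) A (deriv β s) (hnorm s hs) hAh
    rw [hA3, hβ.lift s hs] at hAA hAT
    rw [← hα' s hs] at hAT
    have hα1 : (α s).1 = (β s).1 := by rw [← hβ.lift s hs]; rfl
    have hT : deriv α s ∈ warpedTangent (α s) := by
      rw [hα' s hs, ← hβ.lift s hs]
      exact hopfBarDeriv_mem_warpedTangent (hunit s hs).tangent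
    have hframe := dt_eq_of_frame (by rwa [hα1]) hεε.1 hεε.2 hT
      (hα.tangent_N s hs) (hα.tangent_B s hs)
      (hα.positive s hs) (hα.unit s hs) (hα.inner_NN s hs) (hα.inner_BB s hs) (hα.inner_TN s hs)
      (hα.inner_TB s hs) (hα.inner_NB s hs)
    -- The frame expansion is needed only here: its T-term cancels against the square of g(A, T),
    -- leaving the N and B terms of Q.
    have hdd : warpedMetric f (α s) dt dt = warpedMetric f (α s) dt (deriv α s) ^ 2
        + ε₂ * warpedMetric f (α s) dt (N s) ^ 2 + ε₃ * warpedMetric f (α s) dt (B s) ^ 2 := by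
      have h := congrArg (warpedMetric f (α s) dt) hframe
      rw [warpedMetric_add_right, warpedMetric_add_right, warpedMetric_smul_right,
        warpedMetric_smul_right, warpedMetric_smul_right] at h
      linear_combination h
    have hNT : warpedMetric f (α s) (N s) (deriv α s) = 0 := by
      rw [warpedMetric_comm, hα.inner_TN s hs]
    simp only [warpedMetric_add_left, warpedMetric_smul_left, warpedMetric_add_right,
      warpedMetric_smul_right, hα.inner_NN s hs, hNT, hdd,
      warpedMetric_comm f (α s) (N s) dt] at hAA hAT
    simp only [hHA, hP, warpedMetric_smul_left, warpedMetric_smul_right,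
      warpedMetric_circleActL, warpedMetric_sub_left, warpedMetric_sub_right,
      warpedMetric_comm f (β s) (deriv β s) A, (hunit s hs).unit, ← hAA, ← hAT, Q, hα1, ← hr]
    -- What remains is ε₂³κ² from g(ε₂κN, ε₂κN) against ε₂κ² in Q.
    linear_combination (ε₂ * κ s ^ 2) * hεε.1
  refine ⟨?_, ?_, ?_⟩
  · rw [IsSpacelike, ← hH]
    constructor <;> intro h <;> linarith
  · rw [IsLightlike, ← hH]
    constructor
    · rintro (h | h)
      · rw [h.2, mul_zero]
      · simp [h, warpedMetric]
    · intro h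
      by_cases h0 : H = 0
      · exact Or.inr h0
      · exact Or.inl ⟨h0, by linarith⟩
  · rw [IsTimelike, ← hH]
    constructor <;> intro h <;> linarith
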